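/- **Setting.** Let $n\ge 1$, let $(\mathbb X,\nu)$ and $(\mathbb T,\mu)$ be $\sigma$-finite measure spaces (for instance $\mathbb T=\mathbb R^p$ with Lebesgue measure), and fix an observed privatized output $s_{\mathrm{dp}}$. All functions below are finite, non-negative and measurable. A prior density $p(\theta)$ on $\mathbb T$, a record density $f(\cdot\mid\theta)$ on $\mathbb X$ and a privacy mechanism $\eta(s_{\mathrm{dp}}\mid x)$, $x\in\mathbb X^n$, are given. Put $f(x\mid\theta)=\prod_{i=1}^n f(x_i\mid\theta)$ and $\Theta=\{\theta\in\mathbb T: f(x\mid\theta)>0\text{ for some }x\in\mathbb X\}$; for $\theta\in\Theta$, $f(\cdot\mid\theta)$ is a probability density with respect to $\nu$. Assume $\iint p(\theta)f(x\mid\theta)\eta(s_{\mathrm{dp}}\mid x)\,dx\,d\theta<\infty$, and let $\pi$ be the joint posterior distribution on $\mathbb X^n\times\mathbb T$, with density $p(x,\theta\mid s_{\mathrm{dp}})\propto p(\theta)f(x\mid\theta)\eta(s_{\mathrm{dp}}\mid x)$. A state $(x,\theta)$ is *valid* if $p(\theta)f(x\mid\theta)\eta(s_{\mathrm{dp}}\mid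 x)>0$; let $V$ be the set of valid states. Let $q_\theta(\cdot\mid\theta,x)$ and $q_x(\cdot\mid x_i,x_{-i},\theta,s_{\mathrm{dp}})$ be arbitrary probability densities (proposals) with respect to $\mu$ and $\nu$; $q_x$ may also depend on $i$. One iteration of the Metropolis-within-Gibbs sampler, with transition kernel $P$, is: 1. Propose $\theta^\star\sim q_\theta(\cdot\mid\theta,x)$ and replace $\theta$ by $\theta^\star$ with probability $\min\left\{\frac{q_\theta(\theta\mid\theta^\star,x)\,p(\theta^\star)\,f(x\mid\theta^\star)}{q_\theta(\theta^\star\mid\theta,x)\,p(\theta)\,f(x\mid\theta)},1\right\}$; otherwise keep $\theta$. 2. For $i=1,\dots,n$ in turn: propose $x_i^\star\sim q_x(\cdot\mid x_i,x_{-i},\theta,s_{\mathrm{dp}})$ and replace $x_i$ by $x_i^\star$ with probability $\min\left\{\frac{q_x(x_i\mid x_i^\star,x_{-i},\theta,s_{\mathrm{dp}})\,\eta(s_{\mathrm{dp}}\mid x_i^\star,x_{-i})\,f(x_i^\star\mid\theta)}{q_x(x_i^\star\mid x_i,x_{-i},\theta,s_{\mathrm{dp}})\,\eta(s_{\mathrm{dp}}\mid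 x_i,x_{-i})\,f(x_i\mid\theta)},1\right\}$; otherwise keep $x_i$. (A ratio with zero denominator is read as $0$.) **Theorem.** Assume - A1. The prior is a probability distribution on $\Theta$, that is $\int_\Theta p(\theta)\,d\theta=1$, and $p(\theta)>0$ for all $\theta\in\Theta$. - A2. The set $\{x\in\mathbb X: f(x\mid\theta)>0\}$ is the same for all $\theta\in\Theta$. - A3. $\eta(s_{\mathrm{dp}}\mid x)>0$ for all $x\in\mathbb X^n$. - A4. For every valid state $(x,\theta)$: (a) $q_\theta(\theta^\star\mid\theta,x)>0$ for all $\theta^\star\in\Theta$; (b) for all $i$, $q_x(x_i^\star\mid x_i,x_{-i},\theta,s_{\mathrm{dp}})>0$ for all $x_i^\star$ with $f(x_i^\star,x_{-i}\mid\theta)>0$. Then $\pi$ is a probability measure with $\pi(V)=1$, the Markov kernel $P$ satisfies $P(z,V)=1$ for all $z\in V$, and: 1. (invariance) $\pi P=\pi$; 2. (aperiodicity) for no $d\ge 2$ are there pairwise disjoint non-empty measurable sets $E_0,\dots,E_{d-1}\subseteq V$ with $P(z,E_{i+1 \bmod d})=1$ for all $i$ and all $z\in E_i$; 3. ($\pi$-irreducibility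 within $n$ iterations) for every measurable $A$ with $\pi(A)>0$ and every $z\in V$ there is $1\le k\le n$ with $P^k(z,A)>0$; 4. (ergodicity) for $\pi$-almost every $z$, $\sup_A|P^k(z,A)-\pi(A)|\to 0$ as $k\to\infty$; 5. (uniqueness) $\pi$ is the only $P$-invariant probability measure that gives $V$ mass one, and if for some $z\in V$ and some probability measure $\rho$ one has $\sup_A|P^k(z,A)-\rho(A)|\to 0$, then $\rho=\pi$. -/

import Mathlib

open MeasureTheory ProbabilityTheory Filter
open scoped NNReal ENNReal Topology

noncomputable section

namespace PrivateMCMC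

/-! ## Markov chains: Metropolis-Hastings steps, total variation, aperiodicity, irreducibility -/

section Chains

variable {Z Y : Type*} [MeasurableSpace Z] [MeasurableSpace Y]

/-- A Metropolis-Hastings step that refreshes one component of the state. From the state `z`, a value
`y` is drawn from the density `q z` with respect to `ref`; with probability `a z y` the chain moves to
`move z y`, otherwise it stays at `z`. -/
def mhStep (ref : Measure Y) [SFinite ref] (move : Z → Y → Z) (q a : Z → Y → ℝ≥0)
    (hmove : Measurable (Function.uncurry move)) (hq : Measurable (Function.uncurry q))
    (ha : Measurable (Function.uncurry a)) : Kernel Z Z where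
  toFun z :=
    (ref.withDensity (fun y => (q z y : ℝ≥0∞) * (a z y : ℝ≥0∞))).map (move z) +
      (∫⁻ y, (q z y : ℝ≥0∞) * (1 - (a z y : ℝ≥0∞)) ∂ref) • Measure.dirac z
  measurable' := by
    have hq' : Measurable fun p : Z × Y => (q p.1 p.2 : ℝ≥0∞) := hq.coe_nnreal_ennreal
    have ha' : Measurable fun p : Z × Y => (a p.1 p.2 : ℝ≥0∞) := ha.coe_nnreal_ennreal
    refine Measure.measurable_of_measurable_coe _ fun A hA => ?_
    have hm : ∀ z, Measurable (move z) := fun z => hmove.comp measurable_prodMk_left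
    have h1 : Measurable fun p : Z × Y => A.indicator (fun _ => (1 : ℝ≥0∞)) (move p.1 p.2) :=
      (measurable_const.indicator hA).comp hmove
    have key : ∀ z, (((ref.withDensity (fun y => (q z y : ℝ≥0∞) * (a z y : ℝ≥0∞))).map (move z) +
        (∫⁻ y, (q z y : ℝ≥0∞) * (1 - (a z y : ℝ≥0∞)) ∂ref) • Measure.dirac z) : Measure Z) A =
        (∫⁻ y, (q z y : ℝ≥0∞) * (a z y : ℝ≥0∞) * A.indicator (fun _ => (1 : ℝ≥0∞)) (move z y) ∂ref) +
          (∫⁻ y, (q z y : ℝ≥0∞) * (1 - (a z y : ℝ≥0∞)) ∂ref) * A.indicator 1 z := by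
      intro z
      rw [Measure.add_apply, Measure.smul_apply, Measure.map_apply (hm z) hA,
        withDensity_apply _ (hm z hA), Measure.dirac_apply' _ hA, smul_eq_mul,
        ← lintegral_indicator (hm z hA)]
      congr 1
      refine lintegral_congr fun y => ?_
      by_cases hy : move z y ∈ A <;> simp [Set.indicator, hy]
    simp_rw [key]
    refine Measurable.add ?_ (Measurable.mul ?_ (measurable_one.indicator hA))
    · exact ((hq'.mul ha').mul h1).lintegral_prod_right'
    · exact (hq'.mul (measurable_const.sub ha')).lintegral_prod_right'

/-- Total variation distance `sup_A |ρ₁(A) - ρ₂(A)|`, over measurable sets `A`. -/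
def tvDist (ρ₁ ρ₂ : Measure Z) : ℝ≥0∞ :=
  ⨆ (A : Set Z) (_ : MeasurableSet A), ENNReal.ofReal |ρ₁.real A - ρ₂.real A|

/-- The chain with kernel `P`, run on the set `V` of states, is aperiodic: for no `d ≥ 2` is there a
`d`-cycle, that is, pairwise disjoint non-empty measurable sets `E₀, …, E_{d-1}` inside `V` such that
the chain moves from each point of `E_i` into `E_{i+1}` (indices modulo `d`) with probability one. -/
def IsAperiodicOn (P : Kernel Z Z) (V : Set Z) : Prop :=
  ∀ d : ℕ, 2 ≤ d → ¬ ∃ E : ZMod d → Set Z,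
    (∀ i, MeasurableSet (E i)) ∧ (∀ i, (E i).Nonempty) ∧ (∀ i, E i ⊆ V) ∧
    Pairwise (Function.onFun Disjoint E) ∧ ∀ i, ∀ z ∈ E i, P z (E (i + 1)) = 1

/-- The chain with kernel `P`, run on the set `V` of states, is `φ`-irreducible, and reaches every set
of positive `φ`-measure within `N` steps: for each starting state in `V` there is `1 ≤ k ≤ N` such
that the set carries positive probability after exactly `k` steps. -/
def IsIrreducibleWithin (P : Kernel Z Z) (V : Set Z) (φ : Measure Z) (N : ℕ) : Prop :=
  ∀ A : Set Z, MeasurableSet A → 0 < φ A → ∀ z ∈ V, ∃ k : ℕ, 1 ≤ k ∧ k ≤ N ∧ 0 < (P ^ k) z A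

end Chains

/-! ## The model, the proposals and the sampler -/

variable {n : ℕ} {X T S : Type*} [MeasurableSpace X] [MeasurableSpace T]

/-- Model of `n` i.i.d. confidential records in `X` with a parameter in the ambient space `T` and a
privatized output in `S`; all densities are with respect to `ν` on `X` and `μ` on `T`. -/
structure Model (n : ℕ) (S : Type*) (ν : Measure X) (μ : Measure T) where
  /-- prior density `p(θ)` -/
  prior : T → ℝ≥0
  /-- density `f(x | θ)` of one record -/
  f : T → X → ℝ≥0
  /-- privacy mechanism `η(s | x)` -/
  η : S → (Fin n → X) → ℝ≥0
  measurable_prior : Measurable prior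
  measurable_f : Measurable (Function.uncurry f)
  measurable_η : ∀ s, Measurable (η s)
  /-- `f(· | θ)` is a probability density for each `θ` for which it is not identically zero -/
  lintegral_f : ∀ θ, (∃ x, 0 < f θ x) → ∫⁻ x, f θ x ∂ν = 1

/-- Proposal densities. `qθ (x, θ) θ'` is `q_θ(θ' | θ, x)`; `qx i (x, θ) s y` is the density at `y` of
the proposal `q_x(· | x_i, x_{-i}, θ, s)` for the `i`-th record. -/
structure Proposals (n : ℕ) (S : Type*) (ν : Measure X) (μ : Measure T) where
  qθ : (Fin n → X) × T → T → ℝ≥0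
  qx : Fin n → (Fin n → X) × T → S → X → ℝ≥0
  measurable_qθ : Measurable (Function.uncurry qθ)
  measurable_qx : ∀ i s, Measurable (Function.uncurry fun z y => qx i z s y)
  lintegral_qθ : ∀ z, ∫⁻ θ', qθ z θ' ∂μ = 1
  lintegral_qx : ∀ i z s, ∫⁻ y, qx i z s y ∂ν = 1

variable {ν : Measure X} {μ : Measure T}

namespace Model

variable (M : Model n S ν μ)

/-- The parameter set `Θ = {θ | f(x | θ) > 0 for some x}`. -/
def Θ : Set T := {θ | ∃ x, 0 < M.f θ x}

/-- Density `f(x | θ) = ∏ i, f(x_i | θ)` of the whole database. -/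
def lik (θ : T) (x : Fin n → X) : ℝ≥0 := ∏ i, M.f θ (x i)

/-- The unnormalized joint posterior density `p(θ) f(x | θ) η(s | x)`. -/
def target (s : S) (z : (Fin n → X) × T) : ℝ≥0 := M.prior z.2 * M.lik z.2 z.1 * M.η s z.1

/-- The valid states: those at which the joint posterior density is positive. -/
def validStates (s : S) : Set ((Fin n → X) × T) := {z | 0 < M.target s z}

/-- The normalizing constant `p(s) = ∫∫ p(θ) f(x | θ) η(s | x) dx dθ`. -/
def evidence [SigmaFinite ν] [SigmaFinite μ] (s : S) : ℝ≥0∞ :=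
  ∫⁻ z, M.target s z ∂((Measure.pi fun _ : Fin n => ν).prod μ)

/-- The joint posterior distribution `p(x, θ | s)`. -/
def posterior [SigmaFinite ν] [SigmaFinite μ] (s : S) : Measure ((Fin n → X) × T) :=
  (M.evidence s)⁻¹ •
    ((Measure.pi fun _ : Fin n => ν).prod μ).withDensity (fun z => (M.target s z : ℝ≥0∞))

theorem measurable_lik : Measurable fun z : (Fin n → X) × T => M.lik z.2 z.1 := by
  unfold lik
  refine Finset.measurable_prod _ fun i _ => ?_
  exact M.measurable_f.comp (measurable_snd.prodMk ((measurable_pi_apply i).comp measurable_fst))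

end Model

section Sampler

variable (M : Model n S ν μ) (Q : Proposals n S ν μ)

/-- Acceptance probability of the parameter update; a ratio with denominator zero, which has
probability zero from a valid state, counts as zero. -/
def acceptθ (z : (Fin n → X) × T) (θ' : T) : ℝ≥0 :=
  min ((Q.qθ (z.1, θ') z.2 * M.prior θ' * M.lik θ' z.1) /
    (Q.qθ z θ' * M.prior z.2 * M.lik z.2 z.1)) 1

/-- The state with the `i`-th record replaced by `y`. -/
def setRecord (i : Fin n) (z : (Fin n → X) × T) (y : X) : (Fin n → X) × T :=
  (Function.update z.1 i y, z.2)

/-- Acceptance probability of the update of the `i`-th record (same convention). -/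
def acceptX (s : S) (i : Fin n) (z : (Fin n → X) × T) (y : X) : ℝ≥0 :=
  min ((Q.qx i (setRecord i z y) s (z.1 i) * M.η s (Function.update z.1 i y) * M.f z.2 y) /
    (Q.qx i z s y * M.η s z.1 * M.f z.2 (z.1 i))) 1

theorem measurable_setRecord (i : Fin n) :
    Measurable (Function.uncurry (setRecord (X := X) (T := T) i)) := by
  have h : Measurable fun p : ((Fin n → X) × T) × X => Function.update p.1.1 i p.2 := by
    refine measurable_pi_lambda _ fun j => ?_
    by_cases hj : j = i
    · subst hj
      simpa using measurable_snd
    · simp only [Function.update_of_ne hj]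
      exact (measurable_pi_apply j).comp (measurable_fst.comp measurable_fst)
  exact h.prodMk (measurable_snd.comp measurable_fst)

theorem measurable_acceptθ : Measurable (Function.uncurry (acceptθ M Q)) := by
  have hx : Measurable fun p : ((Fin n → X) × T) × T => (p.1.1, p.2) :=
    (measurable_fst.comp measurable_fst).prodMk measurable_snd
  have hn : Measurable fun p : ((Fin n → X) × T) × T =>
      Q.qθ (p.1.1, p.2) p.1.2 * M.prior p.2 * M.lik p.2 p.1.1 :=
    ((Q.measurable_qθ.comp (hx.prodMk (measurable_snd.comp measurable_fst))).mul
      (M.measurable_prior.comp measurable_snd)).mul (M.measurable_lik.comp hx)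
  have hd : Measurable fun p : ((Fin n → X) × T) × T =>
      Q.qθ p.1 p.2 * M.prior p.1.2 * M.lik p.1.2 p.1.1 :=
    (Q.measurable_qθ.mul (M.measurable_prior.comp (measurable_snd.comp measurable_fst))).mul
      (M.measurable_lik.comp measurable_fst)
  exact (hn.div hd).min measurable_const

theorem measurable_acceptX (s : S) (i : Fin n) : Measurable (Function.uncurry (acceptX M Q s i)) := by
  have hi : Measurable fun p : ((Fin n → X) × T) × X => p.1.1 i :=
    (measurable_pi_apply i).comp (measurable_fst.comp measurable_fst)
  have hθ : Measurable fun p : ((Fin n → X) × T) × X => p.1.2 :=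
    measurable_snd.comp measurable_fst
  have hu := measurable_setRecord (X := X) (T := T) i
  have hn : Measurable fun p : ((Fin n → X) × T) × X =>
      Q.qx i (setRecord i p.1 p.2) s (p.1.1 i) * M.η s (Function.update p.1.1 i p.2) *
        M.f p.1.2 p.2 :=
    (((Q.measurable_qx i s).comp (hu.prodMk hi)).mul
      ((M.measurable_η s).comp (measurable_fst.comp hu))).mul
      (M.measurable_f.comp (hθ.prodMk measurable_snd))
  have hd : Measurable fun p : ((Fin n → X) × T) × X =>
      Q.qx i p.1 s p.2 * M.η s p.1.1 * M.f p.1.2 (p.1.1 i) :=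
    ((Q.measurable_qx i s).mul ((M.measurable_η s).comp (measurable_fst.comp measurable_fst))).mul
      (M.measurable_f.comp (hθ.prodMk hi))
  exact (hn.div hd).min measurable_const

/-- The Metropolis-Hastings update of `θ` given `x`. -/
def stepθ [SFinite μ] : Kernel ((Fin n → X) × T) ((Fin n → X) × T) :=
  mhStep μ (fun z θ' => (z.1, θ')) Q.qθ (acceptθ M Q)
    ((measurable_fst.comp measurable_fst).prodMk measurable_snd) Q.measurable_qθ
    (measurable_acceptθ M Q)

/-- The Metropolis-Hastings update of the `i`-th record given the other records and `θ`. -/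
def stepX [SFinite ν] (s : S) (i : Fin n) : Kernel ((Fin n → X) × T) ((Fin n → X) × T) :=
  mhStep ν (setRecord i) (fun z y => Q.qx i z s y) (acceptX M Q s i)
    (measurable_setRecord i) (Q.measurable_qx i s) (measurable_acceptX M Q s i)

/-- One iteration of the Metropolis-within-Gibbs sampler: the update of `θ`, followed by the updates
of the records in the order `1, …, n`. -/
def sampler [SFinite ν] [SFinite μ] (s : S) : Kernel ((Fin n → X) × T) ((Fin n → X) × T) :=
  (List.finRange n).foldl (fun κ i => stepX M Q s i ∘ₖ κ) (stepθ M Q)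

/-! ## The conditions -/

/-- A1: the prior is a probability distribution on `Θ` and its density is positive there. -/
def A1 : Prop := ∫⁻ θ in M.Θ, M.prior θ ∂μ = 1 ∧ ∀ θ ∈ M.Θ, 0 < M.prior θ

/-- A2: the set `{x | f(x | θ) > 0}` does not depend on `θ ∈ Θ`. -/
def A2 : Prop := ∀ θ ∈ M.Θ, ∀ θ' ∈ M.Θ, {x | 0 < M.f θ x} = {x | 0 < M.f θ' x}

/-- A3: the privacy mechanism is positive at the observed output `s`. -/
def A3 (s : S) : Prop := ∀ x, 0 < M.η s x

/-- A4: from a valid state, (a) `q_θ` is positive on `Θ`, and (b) `q_x` is positive at each value of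
the `i`-th record that keeps the density of the database positive. -/
def A4 (s : S) : Prop :=
  ∀ z ∈ M.validStates s,
    (∀ θ' ∈ M.Θ, 0 < Q.qθ z θ') ∧
    ∀ (i : Fin n) (y : X), 0 < M.lik z.2 (Function.update z.1 i y) → 0 < Q.qx i z s y

end Sampler

end PrivateMCMC

end

/-! With positive probability one iteration accepts all its `n + 1` updates, and these moves alone
have an explicit transition density `g` (`samplerDensity`) with respect to the product reference
measure. By A1-A3 the valid states form a product set, so every intermediate state on the way from
one valid state to another is valid too, and A4 makes all factors of `g` positive: `g > 0` on `V ×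
V`. Hence π is absolutely continuous with respect to `P z` for every valid `z`. Irreducibility
(already in one step) and aperiodicity follow at once. Invariance is detailed balance for each
update separately.

Convergence is a coupling argument. Run two independent copies of the chain. When they stand at `p`,
the measure `C_p × C_p`, with `C_p` the common part of their densities, lies below their joint law
and is symmetric, so it adds the same to the laws of both copies and can be discarded. The mass that
remains (`gap`) bounds the distance of the two laws. Since π × π is invariant for the pair, the
discarded amounts telescope to a sum of at most 1. So for almost every `p` the series `∑ gap k` is
integrable against `C_p × C_p`. A single valid `p` is enough: π is absolutely continuous with
respect to `C_p`, so the series is finite π × π-almost everywhere and `gap k` tends to 0 there.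

For uniqueness, an invariant law on `V` has no part singular to π, so the same almost-everywhere
limit applies to it. The key lemmas are `tendsto_gap_ae`, `absolutelyContinuous_of_invariant`,
`withDensity_samplerDensity_le` and `samplerDensity_pos`. -/

namespace PrivateMCMC

/-! ### Coupling and convergence in total variation for kernels that dominate a positive density -/

section Coupling

variable {Z : Type*} [MeasurableSpace Z]

/-- The part of the transition densities `g p.1` and `g p.2` that they have in common. -/
noncomputable def commonPart (lam : Measure Z) (g : Z → Z → ℝ≥0∞) (p : Z × Z) : Measure Z :=
  lam.withDensity fun w => min (g p.1 w) (g p.2 w)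

/-- Upper bounds for the distance between the laws of two copies of the chain after `k` steps: at each
step, the mass that the independent coupling puts symmetrically on both copies is discarded. -/
noncomputable def gap (P : Kernel Z Z) (lam : Measure Z) (g : Z → Z → ℝ≥0∞) : ℕ → Z × Z → ℝ≥0∞
  | 0 => 1
  | k + 1 => fun p => ∫⁻ q, gap P lam g k q ∂((P ∥ₖ P) p) -
      ∫⁻ q, gap P lam g k q ∂((commonPart lam g p).prod (commonPart lam g p))

variable {P : Kernel Z Z} {lam : Measure Z} {g : Z → Z → ℝ≥0∞}

theorem commonPart_le (hle : ∀ z, lam.withDensity (g z) ≤ P z) (p : Z × Z) :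
    commonPart lam g p ≤ P p.1 ∧ commonPart lam g p ≤ P p.2 :=
  ⟨(withDensity_mono (ae_of_all _ fun _ => min_le_left _ _)).trans (hle _),
    (withDensity_mono (ae_of_all _ fun _ => min_le_right _ _)).trans (hle _)⟩

instance [SFinite lam] (p : Z × Z) : SFinite (commonPart lam g p) := by
  unfold commonPart; infer_instance

theorem lintegral_commonPart_prod [SFinite lam] (hg : Measurable (Function.uncurry g)) (p : Z × Z)
    {u : Z × Z → ℝ≥0∞} (hu : Measurable u) :
    ∫⁻ q, u q ∂((commonPart lam g p).prod (commonPart lam g p)) =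
      ∫⁻ w, min (g p.1 w) (g p.2 w) * ∫⁻ w', min (g p.1 w') (g p.2 w') * u (w, w') ∂lam ∂lam := by
  have hm : Measurable fun w => min (g p.1 w) (g p.2 w) :=
    (hg.comp measurable_prodMk_left).min (hg.comp measurable_prodMk_left)
  rw [lintegral_prod _ hu.aemeasurable]
  unfold commonPart
  rw [lintegral_withDensity_eq_lintegral_mul _ hm hu.lintegral_prod_right']
  refine lintegral_congr fun w => ?_
  rw [Pi.mul_apply, lintegral_withDensity_eq_lintegral_mul _ hm
    (g := fun w' => u (w, w')) (hu.comp measurable_prodMk_left)]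
  rfl

theorem measurable_lintegral_commonPart_prod [SFinite lam] (hg : Measurable (Function.uncurry g))
    {u : Z × Z → ℝ≥0∞} (hu : Measurable u) :
    Measurable fun p => ∫⁻ q, u q ∂((commonPart lam g p).prod (commonPart lam g p)) := by
  simp_rw [lintegral_commonPart_prod hg _ hu]
  have hm : Measurable fun r : (Z × Z) × Z => min (g r.1.1 r.2) (g r.1.2 r.2) :=
    (hg.comp ((measurable_fst.comp measurable_fst).prodMk measurable_snd)).min
      (hg.comp ((measurable_snd.comp measurable_fst).prodMk measurable_snd))
  refine Measurable.lintegral_prod_right' (f := fun r : (Z × Z) × Z => min (g r.1.1 r.2) (g r.1.2 r.2) *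
    ∫⁻ w', min (g r.1.1 w') (g r.1.2 w') * u (r.2, w') ∂lam) (hm.mul ?_)
  refine Measurable.lintegral_prod_right' (f := fun r : ((Z × Z) × Z) × Z =>
    min (g r.1.1.1 r.2) (g r.1.1.2 r.2) * u (r.1.2, r.2)) ?_
  exact (hm.comp ((measurable_fst.comp measurable_fst).prodMk measurable_snd)).mul
    (hu.comp ((measurable_snd.comp measurable_fst).prodMk measurable_snd))

theorem pow_succ_apply_eq_lintegral_left (P : Kernel Z Z) (k : ℕ) (z : Z) {A : Set Z}
    (hA : MeasurableSet A) : (P ^ (k + 1)) z A = ∫⁻ w, (P ^ k) w A ∂(P z) := by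
  rw [add_comm, Kernel.pow_add_apply_eq_lintegral _ _ _ _ hA, pow_one]

theorem measurable_gap [IsMarkovKernel P] [SFinite lam] (hg : Measurable (Function.uncurry g))
    (k : ℕ) :
    Measurable (gap P lam g k) := by
  induction k with
  | zero => exact measurable_one
  | succ k ih => exact ih.lintegral_kernel.sub (measurable_lintegral_commonPart_prod hg ih)

theorem gap_le_one [IsMarkovKernel P] (k : ℕ) (p : Z × Z) : gap P lam g k p ≤ 1 := by
  induction k generalizing p with
  | zero => exact le_rfl
  | succ k ih =>
    refine tsub_le_self.trans ((lintegral_mono ih).trans ?_)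
    simp

theorem commonPart_prod_le [IsMarkovKernel P] [SFinite lam]
    (hle : ∀ z, lam.withDensity (g z) ≤ P z) (p : Z × Z) :
    (commonPart lam g p).prod (commonPart lam g p) ≤ (P ∥ₖ P) p := by
  rw [Kernel.parallelComp_apply]
  exact Measure.prod_mono (commonPart_le hle p).1 (commonPart_le hle p).2

/-- The truncated subtraction in `gap` loses nothing, because the discarded measure lies below the
joint law. -/
theorem gap_succ_add [IsMarkovKernel P] [SFinite lam]
    (hle : ∀ z, lam.withDensity (g z) ≤ P z) (k : ℕ) (p : Z × Z) :
    gap P lam g (k + 1) p +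
      ∫⁻ q, gap P lam g k q ∂((commonPart lam g p).prod (commonPart lam g p)) =
      ∫⁻ q, gap P lam g k q ∂((P ∥ₖ P) p) :=
  tsub_add_cancel_of_le (lintegral_mono' (commonPart_prod_le hle p) le_rfl)

/-- Two copies of the chain are at distance at most `gap` after `k` steps. -/
theorem pow_apply_le_add_gap [IsMarkovKernel P] [SFinite lam]
    (hle : ∀ z, lam.withDensity (g z) ≤ P z) {A : Set Z} (hA : MeasurableSet A) (k : ℕ) (p : Z × Z) :
    (P ^ k) p.1 A ≤ (P ^ k) p.2 A + gap P lam g k p := by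
  induction k generalizing p with
  | zero =>
    refine le_trans ?_ le_add_self
    rw [pow_zero, gap, Pi.one_apply]
    exact prob_le_one (μ := Kernel.id p.1)
  | succ k ih =>
    set a : Z → ℝ≥0∞ := fun w => (P ^ k) w A with ha
    have ham : Measurable a := Kernel.measurable_coe _ hA
    have h1 : Measurable fun q : Z × Z => a q.1 := ham.comp measurable_fst
    have h2 : Measurable fun q : Z × Z => a q.2 := ham.comp measurable_snd
    set C := (commonPart lam g p).prod (commonPart lam g p) with hC
    have hCle : C ≤ (P ∥ₖ P) p := commonPart_prod_le hle p
    have : IsFiniteMeasure C := isFiniteMeasure_of_le _ hCle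
    set D := (P ∥ₖ P) p - C
    have hD : (P ∥ₖ P) p = D + C := (Measure.sub_add_cancel_of_le hCle).symm
    -- `C` is the product of a measure with itself, hence invariant under the swap: the discarded
    -- mass contributes equally to both copies and only `D` can separate them.
    have hsym : ∫⁻ q, a q.1 ∂C = ∫⁻ q, a q.2 ∂C := by
      rw [hC, ← lintegral_prod_swap]; rfl
    have e1 : (P ^ (k + 1)) p.1 A = ∫⁻ q, a q.1 ∂((P ∥ₖ P) p) := by
      rw [pow_succ_apply_eq_lintegral_left _ _ _ hA, Kernel.parallelComp_apply,
        lintegral_prod _ h1.aemeasurable]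
      simp [ha]
    have e2 : (P ^ (k + 1)) p.2 A = ∫⁻ q, a q.2 ∂((P ∥ₖ P) p) := by
      rw [pow_succ_apply_eq_lintegral_left _ _ _ hA, Kernel.parallelComp_apply,
        lintegral_prod _ h2.aemeasurable]
      simp [ha]
    have hgap : gap P lam g (k + 1) p = ∫⁻ q, gap P lam g k q ∂D := by
      have hfin : ∫⁻ q, gap P lam g k q ∂C ≠ ∞ :=
        ((lintegral_mono (gap_le_one k)).trans_lt (by simp)).ne
      rw [← ENNReal.add_left_inj hfin, gap_succ_add hle, hD, lintegral_add_measure]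
    rw [e1, e2, hgap, hD, lintegral_add_measure, lintegral_add_measure, hsym, add_right_comm,
      ← lintegral_add_left h2]
    gcongr with q
    exact ih q

/-- Two independent stationary copies form a stationary pair. -/
theorem bind_parallelComp_of_invariant [IsMarkovKernel P] {ρ : Measure Z} [IsProbabilityMeasure ρ]
    (hρ : P.Invariant ρ) {u : Z × Z → ℝ≥0∞} (hu : Measurable u) :
    ∫⁻ p, ∫⁻ q, u q ∂((P ∥ₖ P) p) ∂(ρ.prod ρ) = ∫⁻ p, u p ∂(ρ.prod ρ) := by
  have hbind : ∀ {v : Z → ℝ≥0∞}, Measurable v → ∫⁻ z, ∫⁻ w, v w ∂(P z) ∂ρ = ∫⁻ z, v z ∂ρ := by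
    intro v hv
    conv_rhs => rw [← hρ.def]
    rw [Measure.lintegral_bind P.aemeasurable hv.aemeasurable]
  have h1 : ∀ z z', ∫⁻ q, u q ∂((P ∥ₖ P) (z, z')) = ∫⁻ w, ∫⁻ w', u (w, w') ∂(P z') ∂(P z) := by
    intro z z'
    rw [Kernel.parallelComp_apply, lintegral_prod _ hu.aemeasurable]
  have hm : Measurable fun r : Z × Z => ∫⁻ w', u (r.2, w') ∂(P r.1) :=
    Measurable.lintegral_kernel_prod_right' (κ := P.comap Prod.fst measurable_fst)
      (f := fun s : (Z × Z) × Z => u (s.1.2, s.2))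
      (hu.comp ((measurable_snd.comp measurable_fst).prodMk measurable_snd))
  rw [lintegral_prod _ hu.lintegral_kernel.aemeasurable, lintegral_prod _ hu.aemeasurable,
    ← hbind hu.lintegral_prod_right']
  refine lintegral_congr fun z => ?_
  simp_rw [h1]
  rw [lintegral_lintegral_swap (f := fun z' w => ∫⁻ w', u (w, w') ∂(P z')) hm.aemeasurable]
  exact lintegral_congr fun w => hbind (hu.comp measurable_prodMk_left)

variable {ρ : Measure Z}

/-- Telescoping: by stationarity of the pair, the mean of `gap` drops at each step by exactly the
discarded amount, starting from 1. -/
theorem sum_lintegral_commonPart_gap_le [IsMarkovKernel P] [SFinite lam]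
    [IsProbabilityMeasure ρ] (hg : Measurable (Function.uncurry g))
    (hle : ∀ z, lam.withDensity (g z) ≤ P z) (hρ : P.Invariant ρ) (N : ℕ) :
    ∫⁻ p, gap P lam g N p ∂(ρ.prod ρ) + ∑ k ∈ Finset.range N, ∫⁻ p, ∫⁻ q, gap P lam g k q
      ∂((commonPart lam g p).prod (commonPart lam g p)) ∂(ρ.prod ρ) = 1 := by
  induction N with
  | zero => simp [gap]
  | succ N ih =>
    rw [Finset.sum_range_succ, add_comm (∑ k ∈ _, _), ← add_assoc,
      ← lintegral_add_left (measurable_gap hg _), ← ih]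
    simp_rw [gap_succ_add hle]
    rw [bind_parallelComp_of_invariant hρ (measurable_gap hg _)]

theorem tendsto_gap_ae [IsMarkovKernel P] [SFinite lam]
    [IsProbabilityMeasure ρ] (hg : Measurable (Function.uncurry g))
    (hle : ∀ z, lam.withDensity (g z) ≤ P z) (hρ : P.Invariant ρ) {V : Set Z}
    (hρV : ρ Vᶜ = 0) (habs : ρ ≪ lam)
    (hpos : ∀ z ∈ V, ∀ w ∈ V, 0 < g z w) :
    ∀ᵐ p ∂(ρ.prod ρ), Tendsto (fun k => gap P lam g k p) atTop (𝓝 0) := by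
  have hgm := fun k => measurable_gap (P := P) (lam := lam) hg k
  set s : Z × Z → ℝ≥0∞ := fun p => ∑' k, gap P lam g k p with hs
  have hsm : Measurable s := Measurable.tsum hgm
  have hsum : ∫⁻ p, ∫⁻ q, s q ∂((commonPart lam g p).prod (commonPart lam g p)) ∂(ρ.prod ρ) ≤ 1 := by
    simp_rw [hs, lintegral_tsum fun k => (hgm k).aemeasurable]
    rw [lintegral_tsum fun k => (measurable_lintegral_commonPart_prod hg (hgm k)).aemeasurable]
    refine ENNReal.tsum_le_of_sum_range_le fun N => ?_
    rw [← sum_lintegral_commonPart_gap_le hg hle hρ N]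
    exact le_add_self
  have hfin := ae_lt_top (measurable_lintegral_commonPart_prod hg hsm)
    (hsum.trans_lt ENNReal.one_lt_top).ne
  have hVae : ∀ᵐ z ∂ρ, z ∈ V := hρV
  have hVV : ∀ᵐ p ∂(ρ.prod ρ), p.1 ∈ V ∧ p.2 ∈ V :=
    (Measure.quasiMeasurePreserving_fst.ae hVae).and (Measure.quasiMeasurePreserving_snd.ae hVae)
  -- One good pair of valid states suffices, since its common part already charges every ρ-positive
  -- set.
  obtain ⟨p, hp, hp1, hp2⟩ := (hfin.and hVV).exists
  have h1 : ∀ᵐ q ∂((commonPart lam g p).prod (commonPart lam g p)), s q < ∞ := ae_lt_top hsm hp.ne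
  have hmm : Measurable fun w => min (g p.1 w) (g p.2 w) :=
    (hg.comp measurable_prodMk_left).min (hg.comp measurable_prodMk_left)
  have hac : ρ ≪ commonPart lam g p := by
    intro A hA
    have h2 : ∀ᵐ w ∂lam, min (g p.1 w) (g p.2 w) ≠ 0 → w ∉ A :=
      (ae_withDensity_iff hmm).1 (measure_eq_zero_iff_ae_notMem.1 hA)
    refine measure_eq_zero_iff_ae_notMem.2 ?_
    filter_upwards [habs.ae_le h2, hVae] with w hw hwV
    exact hw (lt_min (hpos _ hp1 _ hwV) (hpos _ hp2 _ hwV)).ne'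
  filter_upwards [(hac.prod hac).ae_le h1] with q hq
  exact ENNReal.tendsto_atTop_zero_of_tsum_ne_top hq.ne

/-- The reverse inequality comes from the complement of the set. -/
theorem tvDist_le_of_forall_le_add {α β : Measure Z} [IsProbabilityMeasure α]
    [IsProbabilityMeasure β] {ε : ℝ≥0∞} (h : ∀ A, MeasurableSet A → α A ≤ β A + ε) :
    tvDist α β ≤ ε := by
  refine iSup₂_le fun A hA => ?_
  by_cases hε : ε = ∞
  · simp [hε]
  lift ε to ℝ≥0 using hε
  have key : ∀ B, MeasurableSet B → α.real B ≤ β.real B + ε := by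
    intro B hB
    have := ENNReal.toReal_mono (by finiteness) (h B hB)
    rwa [ENNReal.toReal_add (by finiteness) (by finiteness)] at this
  have h1 := key A hA
  have h2 := key Aᶜ hA.compl
  rw [probReal_compl_eq_one_sub hA, probReal_compl_eq_one_sub hA] at h2
  rw [← ENNReal.ofReal_coe_nnreal]
  exact ENNReal.ofReal_le_ofReal (abs_le.2 ⟨by linarith, by linarith⟩)

theorem lintegral_pow_apply_of_invariant (hρ : P.Invariant ρ) (k : ℕ) {A : Set Z}
    (hA : MeasurableSet A) : ∫⁻ z, (P ^ k) z A ∂ρ = ρ A := by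
  have h : (P ^ k).Invariant ρ := by
    induction k with
    | zero => exact Measure.bind_dirac
    | succ k ih => rw [pow_succ]; exact ih.comp hρ
  conv_rhs => rw [← h.def]
  rw [Measure.bind_apply hA (Kernel.aemeasurable _)]

instance isMarkovKernel_pow [IsMarkovKernel P] (k : ℕ) : IsMarkovKernel (P ^ k) := by
  induction k with
  | zero => exact inferInstanceAs (IsMarkovKernel Kernel.id)
  | succ k ih => rw [pow_succ]; exact inferInstanceAs (IsMarkovKernel (_ ∘ₖ _))

/-- The second copy is started from ρ, so its law stays ρ. -/
theorem tvDist_pow_le [IsMarkovKernel P] [SFinite lam]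
    [IsProbabilityMeasure ρ] (hle : ∀ z, lam.withDensity (g z) ≤ P z) (hρ : P.Invariant ρ) (k : ℕ) (z : Z) :
    tvDist ((P ^ k) z) ρ ≤ ∫⁻ z', gap P lam g k (z, z') ∂ρ := by
  refine tvDist_le_of_forall_le_add fun A hA => ?_
  rw [← lintegral_pow_apply_of_invariant hρ k hA,
    ← lintegral_add_left (Kernel.measurable_coe _ hA)]
  calc (P ^ k) z A = ∫⁻ _, (P ^ k) z A ∂ρ := by simp
    _ ≤ _ := lintegral_mono fun z' => pow_apply_le_add_gap hle hA k (z, z')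

/-- A Markov kernel that dominates a positive transition density converges to its invariant
distribution in total variation, from almost every state. -/
theorem tendsto_tvDist_pow_ae [IsMarkovKernel P] [SFinite lam]
    [IsProbabilityMeasure ρ] (hg : Measurable (Function.uncurry g))
    (hle : ∀ z, lam.withDensity (g z) ≤ P z) (hρ : P.Invariant ρ) {V : Set Z}
    (hρV : ρ Vᶜ = 0) (habs : ρ ≪ lam)
    (hpos : ∀ z ∈ V, ∀ w ∈ V, 0 < g z w) :
    ∀ᵐ z ∂ρ, Tendsto (fun k => tvDist ((P ^ k) z) ρ) atTop (𝓝 0) := by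
  filter_upwards [Measure.ae_ae_of_ae_prod (tendsto_gap_ae hg hle hρ hρV habs hpos)] with z hz
  have h := tendsto_lintegral_of_dominated_convergence (μ := ρ) (F := fun k z' => gap P lam g k (z, z'))
    (f := 0) 1 (fun k => (measurable_gap hg k).comp measurable_prodMk_left)
    (fun k => ae_of_all _ fun z' => gap_le_one k _) (by simp) hz
  simp only [Pi.zero_apply, lintegral_zero] at h
  exact tendsto_of_tendsto_of_tendsto_of_le_of_le tendsto_const_nhds h (fun _ => zero_le)
    (fun k => tvDist_pow_le hle hρ k z)

end Coupling

/-! ### Aperiodicity, irreducibility and uniqueness of the invariant and limiting laws -/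

section Consequences

variable {Z : Type*} [MeasurableSpace Z] {P : Kernel Z Z} {lam ρ : Measure Z}
  {g : Z → Z → ℝ≥0∞} {V : Set Z}

theorem absolutelyContinuous_of_withDensity_le (hg : Measurable (Function.uncurry g))
    (hle : ∀ z, lam.withDensity (g z) ≤ P z) (hρV : ρ Vᶜ = 0) (habs : ρ ≪ lam)
    (hpos : ∀ z ∈ V, ∀ w ∈ V, 0 < g z w) {z : Z} (hz : z ∈ V) : ρ ≪ P z := by
  intro A hA
  have h : ∀ᵐ w ∂lam, g z w ≠ 0 → w ∉ A :=
    (ae_withDensity_iff (hg.comp measurable_prodMk_left)).1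
      (measure_eq_zero_iff_ae_notMem.1 (le_antisymm ((hle z A).trans hA.le) zero_le))
  have hVae : ∀ᵐ z ∂ρ, z ∈ V := hρV
  refine measure_eq_zero_iff_ae_notMem.2 ?_
  filter_upwards [habs.ae_le h, hVae] with w hw hwV
  exact hw (hpos _ hz _ hwV).ne'

/-- Every set of a cycle would have full ρ-measure, which two disjoint sets cannot both have. -/
theorem isAperiodicOn_of_absolutelyContinuous [IsMarkovKernel P] [IsProbabilityMeasure ρ]
    (h : ∀ z ∈ V, ρ ≪ P z) : IsAperiodicOn P V := by
  rintro d hd ⟨E, hEm, hne, hEV, hdisj, hE⟩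
  -- Makes `ZMod d` nontrivial, so that `0 + 1 ≠ 1 + 1` below.
  have : Fact (1 < d) := ⟨hd⟩
  have hnull : ∀ i, ρ (E (i + 1))ᶜ = 0 := by
    intro i
    obtain ⟨z, hz⟩ := hne i
    exact h z (hEV i hz) ((prob_compl_eq_zero_iff (hEm _)).2 (hE i z hz))
  have h0 : ρ (E (0 + 1))ᶜ = 0 := hnull 0
  have h1 : ρ (E (1 + 1))ᶜ = 0 := hnull 1
  have hd01 : Disjoint (E (0 + 1)) (E (1 + 1)) := hdisj (by simp)
  have : ρ Set.univ = 0 := by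
    rw [← Set.compl_empty, ← Set.disjoint_iff_inter_eq_empty.1 hd01, Set.compl_inter]
    exact measure_union_null h0 h1
  simp at this

theorem isIrreducibleWithin_of_absolutelyContinuous {N : ℕ} (hN : 1 ≤ N)
    (h : ∀ z ∈ V, ρ ≪ P z) : IsIrreducibleWithin P V ρ N := by
  intro A _ hA z hz
  refine ⟨1, le_rfl, hN, ?_⟩
  rw [pow_one]
  exact pos_iff_ne_zero.2 fun h0 => hA.ne' (h z hz h0)

/-- If all transition laws from `V` dominate the invariant distribution `ρ`, every invariant
distribution on `V` is absolutely continuous with respect to `ρ`. -/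
theorem absolutelyContinuous_of_invariant [IsMarkovKernel P] [IsProbabilityMeasure ρ]
    (h : ∀ z ∈ V, ρ ≪ P z) (hρ : P.Invariant ρ) {σ : Measure Z} [IsProbabilityMeasure σ]
    (hσ : P.Invariant σ) (hσV : σ Vᶜ = 0) : σ ≪ ρ := by
  obtain ⟨N, hN, hsN, hρN⟩ := σ.mutuallySingular_singularPart ρ
  rw [← Measure.singularPart_eq_zero]
  by_contra hne
  set τ := σ.singularPart ρ with hτ
  have hτσ : τ ≤ σ := Measure.singularPart_le _ _
  have hfin : IsFiniteMeasure τ := isFiniteMeasure_of_le σ hτσ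
  have hNc := hN.compl
  have hP : Measurable fun z => P z Nᶜ := Kernel.measurable_coe _ hNc
  have hinv : ∀ {α : Measure Z}, P.Invariant α → ∫⁻ z, P z Nᶜ ∂α = α Nᶜ := by
    intro α hα
    conv_rhs => rw [← hα.def, Measure.bind_apply hNc (Kernel.aemeasurable _)]
  -- `Nᶜ` carries τ and is ρ-null, so the part of σ that is absolutely continuous sends no mass
  -- there: all of `σ Nᶜ` comes from τ.
  have hρ0 : ∀ᵐ z ∂ρ, P z Nᶜ = 0 := by
    have := (hinv hρ).trans hρN
    exact (lintegral_eq_zero_iff hP).1 this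
  have hac : ∀ᵐ z ∂(ρ.withDensity (σ.rnDeriv ρ)), P z Nᶜ = 0 :=
    (withDensity_absolutelyContinuous _ _).ae_le hρ0
  have hdec : σ = τ + ρ.withDensity (σ.rnDeriv ρ) := Measure.haveLebesgueDecomposition_add _ _
  have h1 : ∫⁻ z, P z Nᶜ ∂τ = σ Nᶜ := by
    rw [← hinv hσ]
    conv_rhs => rw [hdec]
    rw [lintegral_add_measure, lintegral_congr_ae hac, lintegral_zero, add_zero]
  -- The mass of τ is at most `σ Nᶜ`, and it has to supply all of `σ Nᶜ`, so nothing is left to go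
  -- to `N`. Then some valid `z` has `P z N = 0`, which forces `ρ N = 0` although ρ lives on `N`.
  have h2 : ∫⁻ z, P z N ∂τ = 0 := by
    have h3 : ∫⁻ z, P z Nᶜ ∂τ + ∫⁻ z, P z N ∂τ = τ Set.univ := by
      rw [← lintegral_add_left hP]
      simp_rw [add_comm (P _ Nᶜ), measure_add_measure_compl hN, measure_univ]
      simp
    have h4 : τ Set.univ ≤ σ Nᶜ := by
      rw [← measure_add_measure_compl hN, hsN, zero_add]
      exact hτσ _
    rw [h1] at h3
    have h5 := h3.le.trans h4
    exact le_antisymm (ENNReal.le_of_add_le_add_left (a := σ Nᶜ) (by finiteness)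
      (by simpa using h5)) zero_le
  have h3 : ∀ᵐ z ∂τ, P z N = 0 := (lintegral_eq_zero_iff (Kernel.measurable_coe _ hN)).1 h2
  have hV : ∀ᵐ z ∂τ, z ∈ V := le_antisymm ((hτσ _).trans hσV.le) zero_le
  have : (ae τ).NeBot := ae_neBot.2 hne
  obtain ⟨z, hz, hzV⟩ := (h3.and hV).exists
  have : ρ Set.univ = 0 := by
    rw [← Set.union_compl_self N]
    exact measure_union_null (h z hzV hz) hρN
  simp at this

/-- The invariant distribution of a Markov kernel that dominates a positive transition density is
unique. -/
theorem eq_of_invariant [IsMarkovKernel P] [SFinite lam] [IsProbabilityMeasure ρ]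
    (hg : Measurable (Function.uncurry g)) (hle : ∀ z, lam.withDensity (g z) ≤ P z)
    (hρ : P.Invariant ρ) (hρV : ρ Vᶜ = 0) (habs : ρ ≪ lam)
    (hpos : ∀ z ∈ V, ∀ w ∈ V, 0 < g z w) {σ : Measure Z} [IsProbabilityMeasure σ]
    (hσ : P.Invariant σ) (hσV : σ Vᶜ = 0) : σ = ρ := by
  have hac : σ ≪ ρ := absolutelyContinuous_of_invariant
    (fun z hz => absolutelyContinuous_of_withDensity_le hg hle hρV habs hpos hz) hρ hσ hσV
  have hgap := (hac.prod (Measure.AbsolutelyContinuous.refl ρ)).ae_le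
    (tendsto_gap_ae hg hle hρ hρV habs hpos)
  have hlim := tendsto_lintegral_of_dominated_convergence (μ := σ.prod ρ)
    (F := fun k => gap P lam g k) (f := 0) 1 (fun k => measurable_gap hg k)
    (fun k => ae_of_all _ fun p => gap_le_one k p) (by simp) hgap
  simp only [Pi.zero_apply, lintegral_zero] at hlim
  -- For measures of equal finite mass one inequality suffices. It is obtained by averaging the
  -- coupling bound over σ × ρ, both marginals being stationary.
  refine Measure.eq_of_le_of_measure_univ_eq (Measure.le_iff.2 fun A hA => ?_) (by simp)
  refine ge_of_tendsto (x := atTop) (b := σ A) (a := ρ A)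
    (f := fun k => ρ A + ∫⁻ p, gap P lam g k p ∂(σ.prod ρ)) ?_ (Eventually.of_forall fun k => ?_)
  · simpa using tendsto_const_nhds.add hlim
  · have hm : Measurable fun z => (P ^ k) z A := Kernel.measurable_coe _ hA
    have h1 : ∫⁻ p, (P ^ k) p.1 A ∂(σ.prod ρ) = σ A :=
      (measurePreserving_fst.lintegral_comp hm).trans (lintegral_pow_apply_of_invariant hσ k hA)
    have h2 : ∫⁻ p, (P ^ k) p.2 A ∂(σ.prod ρ) = ρ A :=
      (measurePreserving_snd.lintegral_comp hm).trans (lintegral_pow_apply_of_invariant hρ k hA)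
    have hm2 : Measurable fun p : Z × Z => (P ^ k) p.2 A := hm.comp measurable_snd
    rw [← h1, ← h2, ← lintegral_add_left hm2]
    exact lintegral_mono fun p => pow_apply_le_add_gap hle hA k p

theorem apply_le_add_tvDist (α β : Measure Z) [IsProbabilityMeasure α] [IsProbabilityMeasure β]
    {A : Set Z} (hA : MeasurableSet A) :
    α A ≤ β A + tvDist α β ∧ β A ≤ α A + tvDist α β := by
  have h : ENNReal.ofReal |α.real A - β.real A| ≤ tvDist α β :=
    le_iSup₂ (f := fun (A : Set Z) (_ : MeasurableSet A) =>
      ENNReal.ofReal |α.real A - β.real A|) A hA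
  have key : ∀ x y : ℝ, 0 ≤ y → ENNReal.ofReal x ≤ ENNReal.ofReal y + ENNReal.ofReal |x - y| := by
    intro x y hy
    rw [← ENNReal.ofReal_add hy (abs_nonneg _)]
    exact ENNReal.ofReal_le_ofReal (by linarith [le_abs_self (x - y)])
  have h1 := key (α.real A) (β.real A) measureReal_nonneg
  have h2 := key (β.real A) (α.real A) measureReal_nonneg
  rw [abs_sub_comm] at h2
  rw [ofReal_measureReal, ofReal_measureReal] at h1 h2
  exact ⟨h1.trans (by gcongr), h2.trans (by gcongr)⟩

/-- Layer-cake formula: the integral of `u` is an average over `t` in `(0, 1]` of the measures of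
its superlevel sets, and the bound holds for each of them. -/
theorem lintegral_le_add_tvDist (α β : Measure Z) [IsProbabilityMeasure α]
    [IsProbabilityMeasure β] {u : Z → ℝ≥0∞} (hu : Measurable u) (hu1 : ∀ z, u z ≤ 1) :
    ∫⁻ z, u z ∂β ≤ ∫⁻ z, u z ∂α + tvDist α β := by
  set v : Z → ℝ := fun z => (u z).toReal with hv
  have hvm : Measurable v := hu.ennreal_toReal
  have huv : ∀ z, u z = ENNReal.ofReal (v z) := fun z =>
    (ENNReal.ofReal_toReal ((hu1 z).trans_lt ENNReal.one_lt_top).ne).symm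
  have hv1 : ∀ z, v z ≤ 1 := fun z => by
    simpa using ENNReal.toReal_mono ENNReal.one_ne_top (hu1 z)
  have layer : ∀ γ : Measure Z, ∫⁻ z, u z ∂γ = ∫⁻ t in Set.Ioc (0 : ℝ) 1, γ {z | t < v z} := by
    intro γ
    simp_rw [huv]
    rw [lintegral_eq_lintegral_meas_lt γ (ae_of_all _ fun z => ENNReal.toReal_nonneg)
      hvm.aemeasurable, ← lintegral_indicator measurableSet_Ioi,
      ← lintegral_indicator measurableSet_Ioc]
    refine lintegral_congr fun t => ?_
    by_cases ht : t ≤ 1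
    · simp [Set.indicator, ht, hv]
    · have : {z | t < (u z).toReal} = ∅ := by
        ext z; simpa using (hv1 z).trans (not_le.1 ht).le
      simp [Set.indicator, ht, this]
  rw [layer, layer]
  calc ∫⁻ t in Set.Ioc (0 : ℝ) 1, β {z | t < v z}
      ≤ ∫⁻ t in Set.Ioc (0 : ℝ) 1, (α {z | t < v z} + tvDist α β) :=
        lintegral_mono fun t => (apply_le_add_tvDist α β (measurableSet_lt measurable_const hvm)).2
    _ = _ := by rw [lintegral_add_right _ measurable_const]; simp

theorem pow_apply_eq_zero (hstay : ∀ z ∈ V, P z Vᶜ = 0) (hV : MeasurableSet V) {z : Z}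
    (hz : z ∈ V) (k : ℕ) : (P ^ k) z Vᶜ = 0 := by
  induction k with
  | zero =>
    rw [pow_zero]
    change Kernel.id z Vᶜ = 0
    rw [Kernel.id_apply, Measure.dirac_apply' _ hV.compl]
    simp [hz]
  | succ k ih =>
    rw [Kernel.pow_succ_apply_eq_lintegral _ _ _ hV.compl]
    have : ∀ᵐ w ∂((P ^ k) z), w ∈ V := ih
    rw [lintegral_congr_ae (this.mono fun w hw => hstay w hw), lintegral_zero]

/-- A limit in total variation of the laws of the chain is invariant. -/
theorem invariant_of_tendsto_tvDist [IsMarkovKernel P] {σ : Measure Z} [IsProbabilityMeasure σ]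
    {z : Z} (h : Tendsto (fun k => tvDist ((P ^ k) z) σ) atTop (𝓝 0)) : P.Invariant σ := by
  refine Measure.eq_of_le_of_measure_univ_eq (Measure.le_iff.2 fun A hA => ?_) ?_
  · rw [Measure.bind_apply hA (Kernel.aemeasurable _)]
    -- One error term replaces σ by the law at time `k` before a step of the chain, the other
    -- replaces the law at time `k + 1` by σ after it.
    have hlim : Tendsto (fun k => σ A + tvDist ((P ^ (k + 1)) z) σ + tvDist ((P ^ k) z) σ) atTop
        (𝓝 (σ A)) := by
      simpa using (tendsto_const_nhds.add ((tendsto_add_atTop_iff_nat 1).2 h)).add h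
    refine ge_of_tendsto hlim (Eventually.of_forall fun k => ?_)
    refine (lintegral_le_add_tvDist ((P ^ k) z) σ (Kernel.measurable_coe _ hA)
      fun w => prob_le_one).trans ?_
    rw [← Kernel.pow_succ_apply_eq_lintegral _ _ _ hA]
    gcongr
    exact (apply_le_add_tvDist _ _ hA).1
  · rw [Measure.bind_apply .univ (Kernel.aemeasurable _)]
    simp

theorem compl_eq_zero_of_tendsto_tvDist [IsMarkovKernel P] (hstay : ∀ z ∈ V, P z Vᶜ = 0)
    (hV : MeasurableSet V) {σ : Measure Z} [IsProbabilityMeasure σ] {z : Z} (hz : z ∈ V)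
    (h : Tendsto (fun k => tvDist ((P ^ k) z) σ) atTop (𝓝 0)) : σ Vᶜ = 0 := by
  refine le_antisymm (ge_of_tendsto h (Eventually.of_forall fun k => ?_)) zero_le
  simpa [pow_apply_eq_zero hstay hV hz k] using
    (apply_le_add_tvDist ((P ^ k) z) σ hV.compl).2

end Consequences

/-! ### Detailed balance for a general Metropolis-Hastings step -/

section MetropolisHastings

variable {Z Y : Type*} [MeasurableSpace Z] [MeasurableSpace Y] {ref : Measure Y} [SFinite ref]
  {move : Z → Y → Z} {q a : Z → Y → ℝ≥0} {hmove : Measurable (Function.uncurry move)}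
  {hq : Measurable (Function.uncurry q)} {ha : Measurable (Function.uncurry a)}

theorem lintegral_mhStep (z : Z) {u : Z → ℝ≥0∞} (hu : Measurable u) :
    ∫⁻ w, u w ∂(mhStep ref move q a hmove hq ha z) =
      ∫⁻ y, (q z y : ℝ≥0∞) * a z y * u (move z y) ∂ref +
        (∫⁻ y, (q z y : ℝ≥0∞) * (1 - (a z y : ℝ≥0∞)) ∂ref) * u z := by
  have hm : Measurable (move z) := hmove.comp measurable_prodMk_left
  have hqa : Measurable fun y => (q z y : ℝ≥0∞) * (a z y : ℝ≥0∞) :=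
    (hq.comp measurable_prodMk_left).coe_nnreal_ennreal.mul
      (ha.comp measurable_prodMk_left).coe_nnreal_ennreal
  change ∫⁻ w, u w ∂((ref.withDensity _).map (move z) + _ • Measure.dirac z) = _
  rw [lintegral_add_measure, lintegral_smul_measure, lintegral_dirac' _ hu, lintegral_map hu hm,
    lintegral_withDensity_eq_lintegral_mul _ hqa
      (g := fun y => u (move z y)) (hu.comp hm)]
  rfl

theorem isMarkovKernel_mhStep (ha1 : ∀ z y, a z y ≤ 1) (hq1 : ∀ z, ∫⁻ y, q z y ∂ref = 1) :
    IsMarkovKernel (mhStep ref move q a hmove hq ha) := by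
  refine ⟨fun z => ⟨?_⟩⟩
  have hqa : Measurable fun y => (q z y : ℝ≥0∞) * (a z y : ℝ≥0∞) :=
    (hq.comp measurable_prodMk_left).coe_nnreal_ennreal.mul
      (ha.comp measurable_prodMk_left).coe_nnreal_ennreal
  rw [← lintegral_one, lintegral_mhStep z measurable_const]
  simp only [mul_one]
  rw [← lintegral_add_left hqa]
  refine (lintegral_congr fun y => ?_).trans (hq1 z)
  rw [← mul_add, add_tsub_cancel_of_le (by exact_mod_cast ha1 z y), mul_one]

theorem le_lintegral_mhStep (z : Z) {u : Z → ℝ≥0∞} (hu : Measurable u) :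
    ∫⁻ y, (q z y : ℝ≥0∞) * a z y * u (move z y) ∂ref ≤
      ∫⁻ w, u w ∂(mhStep ref move q a hmove hq ha z) := by
  rw [lintegral_mhStep z hu]
  exact le_self_add

variable {lam : Measure Z} {t : Z → ℝ≥0} {back : Z → Y}

/-- Detailed balance: if the flow `t z * q z y * a z y` is invariant under the exchange of the move
`z ↦ move z y` with its reverse, the step leaves the measure with density `t` invariant. -/
theorem invariant_mhStep (ht : Measurable t) (ha1 : ∀ z y, a z y ≤ 1)
    (hq1 : ∀ z, ∫⁻ y, q z y ∂ref = 1)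
    (hσ : MeasurePreserving (fun p : Z × Y => (move p.1 p.2, back p.1))
      (lam.prod ref) (lam.prod ref))
    (hk : ∀ z y, t (move z y) * q (move z y) (back z) * a (move z y) (back z) =
      t z * q z y * a z y) :
    (mhStep ref move q a hmove hq ha).Invariant (lam.withDensity fun z => t z) := by
  have hq' : Measurable fun p : Z × Y => (q p.1 p.2 : ℝ≥0∞) := hq.coe_nnreal_ennreal
  have ha' : Measurable fun p : Z × Y => (a p.1 p.2 : ℝ≥0∞) := ha.coe_nnreal_ennreal
  have ht' : Measurable fun z => (t z : ℝ≥0∞) := ht.coe_nnreal_ennreal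
  refine Measure.ext fun A hA => ?_
  set u : Z → ℝ≥0∞ := A.indicator 1 with hu
  have hum : Measurable u := measurable_one.indicator hA
  have hacc : Measurable fun z => ∫⁻ y, (q z y : ℝ≥0∞) * a z y * u (move z y) ∂ref :=
    Measurable.lintegral_prod_right' (f := fun p : Z × Y => (q p.1 p.2 : ℝ≥0∞) * a p.1 p.2 *
      u (move p.1 p.2)) ((hq'.mul ha').mul (hum.comp hmove))
  have hrej : Measurable fun z => ∫⁻ y, (q z y : ℝ≥0∞) * (1 - (a z y : ℝ≥0∞)) ∂ref :=
    (hq'.mul (measurable_const.sub ha')).lintegral_prod_right'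
  -- The exchange of a move with its reverse preserves `lam.prod ref` and the flow, so the accepted
  -- flow into `A` equals the accepted flow out of `A`.
  have hflow : ∫⁻ z, t z * ∫⁻ y, (q z y : ℝ≥0∞) * a z y * u (move z y) ∂ref ∂lam =
      ∫⁻ z, t z * ∫⁻ y, (q z y : ℝ≥0∞) * a z y * u z ∂ref ∂lam := by
    set F : Z × Y → ℝ≥0∞ := fun p => t p.1 * (q p.1 p.2 * a p.1 p.2 * u p.1) with hF
    have hFm : Measurable F := (ht'.comp measurable_fst).mul ((hq'.mul ha').mul
      (hum.comp measurable_fst))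
    have h1 := hσ.lintegral_comp hFm
    have hFc : Measurable fun p : Z × Y => F (move p.1 p.2, back p.1) := hFm.comp hσ.measurable
    rw [lintegral_prod _ hFc.aemeasurable,
      lintegral_prod _ hFm.aemeasurable] at h1
    have hpull : ∀ (z : Z) (v : Y → ℝ≥0∞), ∫⁻ y, t z * v y ∂ref = t z * ∫⁻ y, v y ∂ref :=
      fun z v => lintegral_const_mul' _ _ ENNReal.coe_ne_top
    simp_rw [← hpull]
    rw [← h1]
    refine lintegral_congr fun z => lintegral_congr fun y => ?_
    have h2 : (t (move z y) : ℝ≥0∞) * q (move z y) (back z) * a (move z y) (back z) =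
        t z * q z y * a z y := by exact_mod_cast hk z y
    simp only [hF, ← mul_assoc, h2]
  have hone : ∀ z, ∫⁻ y, (q z y : ℝ≥0∞) * a z y * u z ∂ref +
      (∫⁻ y, (q z y : ℝ≥0∞) * (1 - (a z y : ℝ≥0∞)) ∂ref) * u z = u z := by
    intro z
    have hqa : Measurable fun y => (q z y : ℝ≥0∞) * (a z y : ℝ≥0∞) :=
      (hq'.mul ha').comp measurable_prodMk_left
    rw [lintegral_mul_const _ hqa, ← add_mul, ← lintegral_add_left hqa]
    have : ∀ y, (q z y : ℝ≥0∞) * a z y + q z y * (1 - (a z y : ℝ≥0∞)) = q z y := fun y => by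
      rw [← mul_add, add_tsub_cancel_of_le (by exact_mod_cast ha1 z y), mul_one]
    simp_rw [this, hq1, one_mul]
  rw [Measure.bind_apply hA (Kernel.aemeasurable _)]
  simp_rw [← lintegral_indicator_one hA]
  rw [lintegral_withDensity_eq_lintegral_mul _ ht' hum.lintegral_kernel,
    lintegral_withDensity_eq_lintegral_mul _ ht' hum]
  simp only [Pi.mul_apply]
  simp_rw [lintegral_mhStep _ hum, mul_add]
  have hm1 : Measurable fun z => t z * ∫⁻ y, (q z y : ℝ≥0∞) * a z y * u (move z y) ∂ref :=
    ht'.mul hacc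
  have hm2 : Measurable fun z => t z * ((∫⁻ y, (q z y : ℝ≥0∞) * (1 - (a z y : ℝ≥0∞)) ∂ref) * u z) :=
    ht'.mul (hrej.mul hum)
  rw [lintegral_add_left hm1, hflow, ← lintegral_add_right _ hm2]
  simp_rw [← mul_add, hone]

/-- Under detailed balance the step does not leave the set where the density `t` is positive. -/
theorem mhStep_apply_eq_zero (ht : Measurable t)
    (hk : ∀ z y, t (move z y) * q (move z y) (back z) * a (move z y) (back z) =
      t z * q z y * a z y) {z : Z} (hz : 0 < t z) :
    mhStep ref move q a hmove hq ha z {w | 0 < t w}ᶜ = 0 := by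
  have hA : MeasurableSet {w | 0 < t w}ᶜ := (measurableSet_lt measurable_const ht).compl
  rw [← lintegral_indicator_one hA, lintegral_mhStep z (measurable_one.indicator hA)]
  have h0 : ({w | 0 < t w}ᶜ.indicator 1 z : ℝ≥0∞) = 0 := by simp [hz]
  rw [h0, mul_zero, add_zero]
  refine (lintegral_congr fun y => ?_).trans lintegral_zero
  by_cases hy : 0 < t (move z y)
  · simp [hy]
  -- At a target of density zero the reverse flow vanishes, hence so does the forward one: such a
  -- move is never accepted.
  · have h1 := hk z y
    rw [nonpos_iff_eq_zero.1 (not_lt.1 hy), zero_mul, zero_mul, mul_assoc, eq_comm,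
      mul_eq_zero_iff_left hz.ne'] at h1
    rw [← ENNReal.coe_mul, h1, ENNReal.coe_zero, zero_mul]

/-- Removes the ratio from the acceptance probability. It also holds for `d = 0`, so detailed
balance needs no positivity assumption. -/
theorem mul_min_div_one (n d : ℝ≥0) : d * min (n / d) 1 = min n d := by
  by_cases hd : d = 0
  · simp [hd]
  · rw [mul_min, mul_one, mul_div_cancel₀ _ hd]

end MetropolisHastings

theorem setRecord_setRecord_self {n : ℕ} {X T : Type*} (i : Fin n) (z : (Fin n → X) × T) (y : X) :
    setRecord i (setRecord i z y) (z.1 i) = z := by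
  simp [setRecord]

/-! ### Exchange of coordinates preserves product measures -/

section Exchange

variable {A B C : Type*} [MeasurableSpace A] [MeasurableSpace B] [MeasurableSpace C]

theorem measurePreserving_prod_right_comm (α : Measure A) (β : Measure B) (γ : Measure C)
    [SFinite α] [SFinite β] [SFinite γ] :
    MeasurePreserving (fun p : (A × B) × C => ((p.1.1, p.2), p.1.2))
      ((α.prod β).prod γ) ((α.prod γ).prod β) :=
  ((measurePreserving_prodAssoc α γ β).symm MeasurableEquiv.prodAssoc).comp
    (((MeasurePreserving.id α).prod Measure.measurePreserving_swap).comp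
      (measurePreserving_prodAssoc α β γ))

theorem measurePreserving_update (α : Measure A) [SigmaFinite α] {n : ℕ} (i : Fin n) :
    MeasurePreserving (fun p : (Fin n → A) × A => (Function.update p.1 i p.2, p.1 i))
      ((Measure.pi fun _ : Fin n => α).prod α) ((Measure.pi fun _ : Fin n => α).prod α) := by
  cases n with
  | zero => exact i.elim0
  | succ m =>
    have he := measurePreserving_piFinSuccAbove (fun _ : Fin (m + 1) => α) i
    have hsw : MeasurePreserving (Prod.swap : A × (Fin m → A) → _) _ _ :=
      Measure.measurePreserving_swap (μ := α) (ν := Measure.pi fun _ : Fin m => α)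
    have hsw' : MeasurePreserving (Prod.swap : (Fin m → A) × A → _) _ _ :=
      Measure.measurePreserving_swap (μ := Measure.pi fun _ : Fin m => α) (ν := α)
    -- Split off the `i`-th coordinate, exchange it with the extra one, and reassemble.
    have h := ((he.symm _).prod (MeasurePreserving.id α)).comp
      ((hsw'.prod (MeasurePreserving.id α)).comp
        ((measurePreserving_prod_right_comm (Measure.pi fun _ : Fin m => α) α α).comp
          ((hsw.prod (MeasurePreserving.id α)).comp (he.prod (MeasurePreserving.id α)))))
    convert h using 1
    funext p
    refine Prod.ext ?_ rfl
    change _ = i.insertNth p.2 (i.removeNth p.1)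
    rw [Fin.insertNth_removeNth]

theorem measurePreserving_setRecord {X T : Type*} [MeasurableSpace X] [MeasurableSpace T]
    (ν : Measure X) [SigmaFinite ν] (μ : Measure T) [SFinite μ] {n : ℕ} (i : Fin n) :
    MeasurePreserving (fun p : ((Fin n → X) × T) × X => (setRecord i p.1 p.2, p.1.1 i))
      (((Measure.pi fun _ : Fin n => ν).prod μ).prod ν)
      (((Measure.pi fun _ : Fin n => ν).prod μ).prod ν) :=
  (measurePreserving_prod_right_comm _ _ _).comp
    (((measurePreserving_update ν i).prod (MeasurePreserving.id μ)).comp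
      (measurePreserving_prod_right_comm _ _ _))

end Exchange

variable {n : ℕ} {X T S : Type*} [MeasurableSpace X] [MeasurableSpace T]
  {ν : Measure X} {μ : Measure T}

/-! ### The updates of the sampler: detailed balance, invariance, validity -/

section Steps

variable (M : Model n S ν μ) (Q : Proposals n S ν μ) (s : S)

theorem measurable_target : Measurable (M.target s) :=
  ((M.measurable_prior.comp measurable_snd).mul M.measurable_lik).mul
    ((M.measurable_η s).comp measurable_fst)

/-- Writes the flow as a factor that does not involve the parameter times a minimum whose two
entries trade places when the move is reversed. -/
theorem flow_stepθ (z : (Fin n → X) × T) (θ' : T) :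
    M.target s z * Q.qθ z θ' * acceptθ M Q z θ' =
      M.η s z.1 * min (Q.qθ (z.1, θ') z.2 * M.prior θ' * M.lik θ' z.1)
        (Q.qθ z θ' * M.prior z.2 * M.lik z.2 z.1) := by
  rw [← mul_min_div_one, Model.target, acceptθ]
  ring

theorem flow_stepθ_symm (z : (Fin n → X) × T) (θ' : T) :
    M.target s (z.1, θ') * Q.qθ (z.1, θ') z.2 * acceptθ M Q (z.1, θ') z.2 =
      M.target s z * Q.qθ z θ' * acceptθ M Q z θ' := by
  rw [flow_stepθ, flow_stepθ, min_comm]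

/-- The factors of the target density that do not change when the `i`-th record is updated. -/
def otherFactors (i : Fin n) (z : (Fin n → X) × T) : ℝ≥0 :=
  M.prior z.2 * ∏ j ∈ Finset.univ.erase i, M.f z.2 (z.1 j)

theorem otherFactors_setRecord (i : Fin n) (z : (Fin n → X) × T) (y : X) :
    otherFactors M i (setRecord i z y) = otherFactors M i z := by
  unfold otherFactors setRecord
  congr 1
  refine Finset.prod_congr rfl fun j hj => ?_
  simp only [Function.update_of_ne (Finset.ne_of_mem_erase hj)]

theorem target_eq_otherFactors_mul (i : Fin n) (z : (Fin n → X) × T) :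
    M.target s z = otherFactors M i z * (M.η s z.1 * M.f z.2 (z.1 i)) := by
  rw [Model.target, Model.lik, otherFactors, ← Finset.mul_prod_erase _ _ (Finset.mem_univ i)]
  ring

theorem flow_stepX (i : Fin n) (z : (Fin n → X) × T) (y : X) :
    M.target s z * Q.qx i z s y * acceptX M Q s i z y =
      otherFactors M i z *
        min (Q.qx i (setRecord i z y) s (z.1 i) * M.η s (Function.update z.1 i y) * M.f z.2 y)
          (Q.qx i z s y * M.η s z.1 * M.f z.2 (z.1 i)) := by
  rw [← mul_min_div_one, target_eq_otherFactors_mul M s i, acceptX]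
  ring

theorem flow_stepX_symm (i : Fin n) (z : (Fin n → X) × T) (y : X) :
    M.target s (setRecord i z y) * Q.qx i (setRecord i z y) s (z.1 i) *
        acceptX M Q s i (setRecord i z y) (z.1 i) =
      M.target s z * Q.qx i z s y * acceptX M Q s i z y := by
  have h1 : (setRecord i z y).1 i = y := by simp [setRecord]
  have h2 : Function.update (setRecord i z y).1 i (z.1 i) = z.1 := by simp [setRecord]
  rw [flow_stepX, flow_stepX, otherFactors_setRecord, min_comm, setRecord_setRecord_self, h1, h2]
  rfl

theorem acceptθ_le_one (z : (Fin n → X) × T) (θ' : T) : acceptθ M Q z θ' ≤ 1 := min_le_right _ _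

theorem acceptX_le_one (i : Fin n) (z : (Fin n → X) × T) (y : X) : acceptX M Q s i z y ≤ 1 :=
  min_le_right _ _

instance isMarkovKernel_stepθ [SFinite μ] : IsMarkovKernel (stepθ M Q) :=
  isMarkovKernel_mhStep (acceptθ_le_one M Q) Q.lintegral_qθ

instance isMarkovKernel_stepX [SFinite ν] (i : Fin n) : IsMarkovKernel (stepX M Q s i) :=
  isMarkovKernel_mhStep (acceptX_le_one M Q s i) fun z => Q.lintegral_qx i z s

theorem invariant_stepθ [SigmaFinite ν] [SigmaFinite μ] :
    (stepθ M Q).Invariant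
      (((Measure.pi fun _ : Fin n => ν).prod μ).withDensity fun z => M.target s z) :=
  invariant_mhStep (back := Prod.snd) (measurable_target M s) (acceptθ_le_one M Q) Q.lintegral_qθ
    (measurePreserving_prod_right_comm _ _ _) (flow_stepθ_symm M Q s)

theorem invariant_stepX [SigmaFinite ν] [SigmaFinite μ] (i : Fin n) :
    (stepX M Q s i).Invariant
      (((Measure.pi fun _ : Fin n => ν).prod μ).withDensity fun z => M.target s z) :=
  invariant_mhStep (back := fun z => z.1 i) (measurable_target M s) (acceptX_le_one M Q s i)
    (fun z => Q.lintegral_qx i z s) (measurePreserving_setRecord ν μ i) (flow_stepX_symm M Q s i)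

/-- Transfers a property from the parameter update to the whole iteration; used for the Markov
property, invariance and validity. -/
theorem foldl_stepX_induction [SFinite ν]
    {p : Kernel ((Fin n → X) × T) ((Fin n → X) × T) → Prop}
    (hstep : ∀ i κ, p κ → p (stepX M Q s i ∘ₖ κ)) (l : List (Fin n))
    {κ : Kernel ((Fin n → X) × T) ((Fin n → X) × T)} (hκ : p κ) :
    p (l.foldl (fun κ i => stepX M Q s i ∘ₖ κ) κ) := by
  induction l generalizing κ with
  | nil => exact hκ
  | cons i l ih => exact ih (hstep i κ hκ)

instance isMarkovKernel_sampler [SFinite ν] [SFinite μ] : IsMarkovKernel (sampler M Q s) :=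
  foldl_stepX_induction M Q s (p := fun κ => IsMarkovKernel κ)
    (fun _ _ _ => inferInstance) _ inferInstance

theorem invariant_sampler [SigmaFinite ν] [SigmaFinite μ] :
    (sampler M Q s).Invariant (M.posterior s) := by
  have h := foldl_stepX_induction M Q s (p := fun κ => κ.Invariant
      (((Measure.pi fun _ : Fin n => ν).prod μ).withDensity fun z => M.target s z))
    (fun i _ hκ => (invariant_stepX M Q s i).comp hκ) (List.finRange n) (invariant_stepθ M Q s)
  unfold Model.posterior
  rw [Kernel.Invariant, Measure.comp_smul]
  exact congrArg _ h

theorem measurableSet_validStates : MeasurableSet (M.validStates s) :=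
  measurableSet_lt measurable_const (measurable_target M s)

theorem sampler_compl_validStates [SFinite ν] [SFinite μ] {z : (Fin n → X) × T}
    (hz : z ∈ M.validStates s) : sampler M Q s z (M.validStates s)ᶜ = 0 := by
  have hV := (measurableSet_validStates M s).compl
  refine foldl_stepX_induction M Q s (p := fun κ => κ z (M.validStates s)ᶜ = 0)
    (fun i κ hκ => ?_) _ (mhStep_apply_eq_zero (back := Prod.snd) (measurable_target M s)
      (flow_stepθ_symm M Q s) hz)
  rw [Kernel.comp_apply' _ _ _ hV]
  have hκ' : ∀ᵐ w ∂(κ z), w ∈ M.validStates s := hκ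
  have hstay : ∀ᵐ w ∂(κ z), stepX M Q s i w (M.validStates s)ᶜ = 0 :=
    hκ'.mono fun w hw => mhStep_apply_eq_zero (back := fun z => z.1 i)
      (measurable_target M s) (flow_stepX_symm M Q s i) hw
  rw [lintegral_congr_ae hstay, lintegral_zero]

end Steps

/-! ### A transition density dominated by one iteration -/

section Density

variable (M : Model n S ν μ) (Q : Proposals n S ν μ) (s : S)

/-- The density at `w` of moving from `z` by accepting the updates of all the records in the list. -/
noncomputable def recordDensity : List (Fin n) → (Fin n → X) × T → (Fin n → X) → ℝ≥0∞
  | [], _, _ => 1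
  | i :: l, z, w => (Q.qx i z s (w i) : ℝ≥0∞) * acceptX M Q s i z (w i) *
      recordDensity l (setRecord i z (w i)) w

/-- The integral of `u` over the moves from `z` that accept the updates of all the records in the
list. -/
noncomputable def recordIntegral (u : (Fin n → X) × T → ℝ≥0∞) : List (Fin n) → (Fin n → X) × T → ℝ≥0∞
  | [], z => u z
  | i :: l, z => ∫⁻ y, (Q.qx i z s y : ℝ≥0∞) * acceptX M Q s i z y *
      recordIntegral u l (setRecord i z y) ∂ν

/-- The density of moving from `z` to `w` by accepting all the updates of one iteration. -/
noncomputable def samplerDensity (z w : (Fin n → X) × T) : ℝ≥0∞ :=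
  (Q.qθ z w.2 : ℝ≥0∞) * acceptθ M Q z w.2 *
    recordDensity M Q s (List.finRange n) (z.1, w.2) w.1

theorem measurable_recordDensity (l : List (Fin n)) :
    Measurable (Function.uncurry (recordDensity M Q s l)) := by
  induction l with
  | nil => exact measurable_const
  | cons i l ih =>
    have hm : Measurable fun p : ((Fin n → X) × T) × (Fin n → X) => (p.1, p.2 i) :=
      measurable_fst.prodMk ((measurable_pi_apply i).comp measurable_snd)
    exact (((Q.measurable_qx i s).comp hm).coe_nnreal_ennreal.mul
      ((measurable_acceptX M Q s i).comp hm).coe_nnreal_ennreal).mul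
      (ih.comp (((measurable_setRecord i).comp hm).prodMk measurable_snd))

theorem measurable_samplerDensity : Measurable (Function.uncurry (samplerDensity M Q s)) := by
  have hm : Measurable fun p : ((Fin n → X) × T) × ((Fin n → X) × T) => (p.1, p.2.2) :=
    measurable_fst.prodMk (measurable_snd.comp measurable_snd)
  refine ((Q.measurable_qθ.comp hm).coe_nnreal_ennreal.mul
    ((measurable_acceptθ M Q).comp hm).coe_nnreal_ennreal).mul
    ((measurable_recordDensity M Q s _).comp (Measurable.prodMk ?_ ?_))
  · exact (measurable_fst.comp measurable_fst).prodMk (measurable_snd.comp measurable_snd)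
  · exact measurable_fst.comp measurable_snd

theorem measurable_recordIntegral [SFinite ν] {u : (Fin n → X) × T → ℝ≥0∞} (hu : Measurable u)
    (l : List (Fin n)) : Measurable (recordIntegral M Q s u l) := by
  induction l with
  | nil => exact hu
  | cons i l ih =>
    exact Measurable.lintegral_prod_right' (f := fun p : ((Fin n → X) × T) × X =>
      (Q.qx i p.1 s p.2 : ℝ≥0∞) * acceptX M Q s i p.1 p.2 *
        recordIntegral M Q s u l (setRecord i p.1 p.2))
      (((Q.measurable_qx i s).coe_nnreal_ennreal.mul
        (measurable_acceptX M Q s i).coe_nnreal_ennreal).mul (ih.comp (measurable_setRecord i)))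

/-- Each update only loses mass when its rejection part is dropped. The kernel `κ` varies because
the fold accumulates the updates already made. -/
theorem lintegral_recordIntegral_le [SFinite ν] {u : (Fin n → X) × T → ℝ≥0∞} (hu : Measurable u)
    (l : List (Fin n)) (κ : Kernel ((Fin n → X) × T) ((Fin n → X) × T)) (z : (Fin n → X) × T) :
    ∫⁻ w, recordIntegral M Q s u l w ∂(κ z) ≤
      ∫⁻ w, u w ∂(l.foldl (fun κ i => stepX M Q s i ∘ₖ κ) κ z) := by
  induction l generalizing κ with
  | nil => exact le_rfl
  | cons i l ih =>
    refine le_trans ?_ (ih (stepX M Q s i ∘ₖ κ))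
    rw [Kernel.lintegral_comp _ _ _ (measurable_recordIntegral M Q s hu l)]
    exact lintegral_mono fun w => le_lintegral_mhStep w (measurable_recordIntegral M Q s hu l)

/-- As no record is updated twice, the nested integrals over proposals merge into one integral over
the final values of the records. -/
theorem recordIntegral_eq_lmarginal [SigmaFinite ν] {u : (Fin n → X) × T → ℝ≥0∞}
    (hu : Measurable u) {l : List (Fin n)} (hl : l.Nodup) (z : (Fin n → X) × T) :
    recordIntegral M Q s u l z =
      lmarginal (fun _ : Fin n => ν) l.toFinset
        (fun w => recordDensity M Q s l z w * u (w, z.2)) z.1 := by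
  induction l generalizing z with
  | nil => simp [recordIntegral, recordDensity]
  | cons i l ih =>
    obtain ⟨hi, hl⟩ := List.nodup_cons.1 hl
    have hi' : i ∉ l.toFinset := by simpa using hi
    have hm : Measurable fun w => recordDensity M Q s (i :: l) z w * u (w, z.2) :=
      ((measurable_recordDensity M Q s (i :: l)).comp measurable_prodMk_left).mul
        (hu.comp measurable_prodMk_right)
    rw [List.toFinset_cons, lmarginal_insert _ hm hi', recordIntegral]
    refine lintegral_congr fun y => ?_
    rw [ih hl, lmarginal, lmarginal, ← lintegral_const_mul' _ _ (by finiteness)]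
    refine lintegral_congr fun w => ?_
    -- Later updates leave record `i` alone, so its final value is the proposal `y`.
    have hy : Function.updateFinset (Function.update z.1 i y) l.toFinset w i = y := by
      simp [Function.updateFinset, hi]
    rw [recordDensity, hy, ← mul_assoc]
    rfl

/-- One iteration of the sampler dominates the moves that accept all the updates. -/
theorem withDensity_samplerDensity_le [SigmaFinite ν] [SigmaFinite μ] (z : (Fin n → X) × T) :
    ((Measure.pi fun _ : Fin n => ν).prod μ).withDensity (samplerDensity M Q s z) ≤
      sampler M Q s z := by
  refine Measure.le_iff.2 fun A hA => ?_
  set u : (Fin n → X) × T → ℝ≥0∞ := A.indicator 1 with hu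
  have hum : Measurable u := measurable_one.indicator hA
  have hd : Measurable (samplerDensity M Q s z) :=
    (measurable_samplerDensity M Q s).comp measurable_prodMk_left
  rw [← lintegral_indicator_one hA, ← lintegral_indicator_one hA,
    lintegral_withDensity_eq_lintegral_mul _ hd hum, lintegral_prod_symm _ (hd.mul hum).aemeasurable]
  refine le_trans ?_ (lintegral_recordIntegral_le M Q s hum (List.finRange n) (stepθ M Q) z)
  refine le_trans (lintegral_mono fun θ => ?_)
    (le_lintegral_mhStep z (measurable_recordIntegral M Q s hum _))
  have huniv : (List.finRange n).toFinset = Finset.univ := by ext; simp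
  rw [recordIntegral_eq_lmarginal M Q s hum (List.nodup_finRange n), huniv, lmarginal_univ,
    ← lintegral_const_mul' _ _ (by finiteness)]
  refine lintegral_mono fun x => ?_
  rw [Pi.mul_apply, samplerDensity, mul_assoc]

end Density

/-! ### Valid states, positivity of the density and of the evidence -/

section Positivity

variable {M : Model n S ν μ} {Q : Proposals n S ν μ} {s : S}

theorem mem_validStates_iff {z : (Fin n → X) × T} :
    z ∈ M.validStates s ↔ 0 < M.prior z.2 ∧ (∀ i, 0 < M.f z.2 (z.1 i)) ∧ 0 < M.η s z.1 := by
  simp [Model.validStates, Model.target, Model.lik, pos_iff_ne_zero, Finset.prod_eq_zero_iff,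
    and_assoc]

/-- The conditions on the parameter and on each record decouple because the support of a record is
common to all of `Θ`. With `1 ≤ n` there is a record to witness that the parameter lies in `Θ`. -/
theorem mem_validStates_iff_exists (hn : 1 ≤ n) (hA1 : A1 M) (hA2 : A2 M) (hA3 : A3 M s)
    {z : (Fin n → X) × T} :
    z ∈ M.validStates s ↔ z.2 ∈ M.Θ ∧ ∀ i, ∃ θ, 0 < M.f θ (z.1 i) := by
  rw [mem_validStates_iff]
  constructor
  · rintro ⟨-, hf, -⟩
    exact ⟨⟨_, hf ⟨0, hn⟩⟩, fun i => ⟨_, hf i⟩⟩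
  · rintro ⟨hθ, hf⟩
    refine ⟨hA1.2 _ hθ, fun i => ?_, hA3 _⟩
    obtain ⟨θ, h⟩ := hf i
    have : z.1 i ∈ {x | 0 < M.f θ x} := h
    rwa [hA2 θ ⟨_, h⟩ _ hθ] at this

theorem validStates_eq (hn : 1 ≤ n) (hA1 : A1 M) (hA2 : A2 M) (hA3 : A3 M s) :
    M.validStates s = (Set.univ.pi fun _ => {x | ∃ θ, 0 < M.f θ x}) ×ˢ M.Θ := by
  ext z
  simp [mem_validStates_iff_exists hn hA1 hA2 hA3, and_comm]

theorem replaceParameter_mem (hn : 1 ≤ n) (hA1 : A1 M) (hA2 : A2 M) (hA3 : A3 M s)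
    {z w : (Fin n → X) × T} (hz : z ∈ M.validStates s) (hw : w ∈ M.validStates s) :
    (z.1, w.2) ∈ M.validStates s := by
  rw [mem_validStates_iff_exists hn hA1 hA2 hA3] at hz hw ⊢
  exact ⟨hw.1, hz.2⟩

theorem setRecord_mem (hn : 1 ≤ n) (hA1 : A1 M) (hA2 : A2 M) (hA3 : A3 M s)
    {z w : (Fin n → X) × T} (hz : z ∈ M.validStates s) (hw : w ∈ M.validStates s) (i : Fin n) :
    setRecord i z (w.1 i) ∈ M.validStates s := by
  rw [mem_validStates_iff_exists hn hA1 hA2 hA3] at hz hw ⊢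
  refine ⟨hz.1, fun j => ?_⟩
  by_cases hj : j = i
  · subst hj
    simpa [setRecord] using hw.2 j
  · simpa [setRecord, hj] using hz.2 j

theorem lik_pos {z : (Fin n → X) × T} (hz : z ∈ M.validStates s) : 0 < M.lik z.2 z.1 :=
  Finset.prod_pos fun i _ => (mem_validStates_iff.1 hz).2.1 i

theorem qx_pos (hA4 : A4 M Q s) {z : (Fin n → X) × T} (hz : z ∈ M.validStates s) {i : Fin n}
    {y : X} (hy : setRecord i z y ∈ M.validStates s) : 0 < Q.qx i z s y :=
  (hA4 z hz).2 i y (lik_pos hy)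

theorem acceptX_pos (hA4 : A4 M Q s) {z : (Fin n → X) × T} (hz : z ∈ M.validStates s) {i : Fin n}
    {y : X} (hy : setRecord i z y ∈ M.validStates s) : 0 < acceptX M Q s i z y := by
  have hz' := mem_validStates_iff.1 hz
  have hy' := mem_validStates_iff.1 hy
  -- A4 applied at the new state, which is valid: the reverse proposal leads back to the valid state
  -- `z`.
  have h1 : 0 < Q.qx i (setRecord i z y) s (z.1 i) :=
    qx_pos hA4 hy (by rwa [setRecord_setRecord_self])
  have h2 : 0 < M.f z.2 y := by simpa [setRecord] using hy'.2.1 i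
  exact lt_min (div_pos (mul_pos (mul_pos h1 hy'.2.2) h2)
    (mul_pos (mul_pos (qx_pos hA4 hz hy) hz'.2.2) (hz'.2.1 i))) one_pos

theorem acceptθ_pos (hn : 1 ≤ n) (hA4 : A4 M Q s) {z : (Fin n → X) × T}
    (hz : z ∈ M.validStates s) {θ' : T} (hθ' : (z.1, θ') ∈ M.validStates s) :
    0 < Q.qθ z θ' ∧ 0 < acceptθ M Q z θ' := by
  have hΘ : ∀ {w : (Fin n → X) × T}, w ∈ M.validStates s → w.2 ∈ M.Θ := fun hw =>
    ⟨_, (mem_validStates_iff.1 hw).2.1 ⟨0, hn⟩⟩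
  have hq : 0 < Q.qθ z θ' := (hA4 z hz).1 θ' (hΘ hθ')
  have hq' : 0 < Q.qθ (z.1, θ') z.2 := (hA4 _ hθ').1 z.2 (hΘ hz)
  exact ⟨hq, lt_min (div_pos (mul_pos (mul_pos hq' (mem_validStates_iff.1 hθ').1) (lik_pos hθ'))
    (mul_pos (mul_pos hq (mem_validStates_iff.1 hz).1) (lik_pos hz))) one_pos⟩

theorem recordDensity_pos (hn : 1 ≤ n) (hA1 : A1 M) (hA2 : A2 M) (hA3 : A3 M s) (hA4 : A4 M Q s)
    (l : List (Fin n)) {z w : (Fin n → X) × T} (hz : z ∈ M.validStates s)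
    (hw : w ∈ M.validStates s) : 0 < recordDensity M Q s l z w.1 := by
  induction l generalizing z with
  | nil => exact one_pos
  | cons i l ih =>
    have hi := setRecord_mem hn hA1 hA2 hA3 hz hw i
    have h1 := ENNReal.coe_pos.2 (qx_pos hA4 hz hi)
    have h2 := ENNReal.coe_pos.2 (acceptX_pos hA4 hz hi)
    exact ENNReal.mul_pos (ENNReal.mul_pos h1.ne' h2.ne').ne' (ih hi).ne'

theorem samplerDensity_pos (hn : 1 ≤ n) (hA1 : A1 M) (hA2 : A2 M) (hA3 : A3 M s)
    (hA4 : A4 M Q s) {z w : (Fin n → X) × T} (hz : z ∈ M.validStates s)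
    (hw : w ∈ M.validStates s) : 0 < samplerDensity M Q s z w := by
  have hzw := replaceParameter_mem hn hA1 hA2 hA3 hz hw
  obtain ⟨h1, h2⟩ := acceptθ_pos hn hA4 hz hzw
  exact ENNReal.mul_pos (ENNReal.mul_pos (ENNReal.coe_pos.2 h1).ne' (ENNReal.coe_pos.2 h2).ne').ne'
    (recordDensity_pos hn hA1 hA2 hA3 hA4 _ hzw hw).ne'

variable [SigmaFinite ν] [SigmaFinite μ]

/-- The target is positive on a product of sets of positive measure: `Θ` carries the prior mass 1,
and the common support carries a record density of integral 1. -/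
theorem evidence_ne_zero (hn : 1 ≤ n) (hA1 : A1 M) (hA2 : A2 M) (hA3 : A3 M s) :
    M.evidence s ≠ 0 := by
  intro h0
  have hΘ : μ M.Θ ≠ 0 := by
    intro h
    have h1 := hA1.1
    rw [Measure.restrict_eq_zero.2 h, lintegral_zero_measure] at h1
    exact zero_ne_one h1
  obtain ⟨θ, x, hx⟩ := nonempty_of_measure_ne_zero hΘ
  have hX : ν {x | ∃ θ, 0 < M.f θ x} ≠ 0 := by
    intro h
    have h1 : ∫⁻ x, M.f θ x ∂ν = 0 := by
      refine (lintegral_congr_ae ?_).trans lintegral_zero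
      filter_upwards [measure_eq_zero_iff_ae_notMem.1 h] with x hx
      have : ¬ 0 < M.f θ x := fun h => hx ⟨θ, h⟩
      simpa using this
    exact one_ne_zero ((M.lintegral_f θ ⟨x, hx⟩).symm.trans h1)
  have hV : ((Measure.pi fun _ : Fin n => ν).prod μ) (M.validStates s) = 0 := by
    refine measure_eq_zero_iff_ae_notMem.2 ?_
    filter_upwards [(lintegral_eq_zero_iff (measurable_target M s).coe_nnreal_ennreal).1 h0]
      with z hz hzV
    exact (ENNReal.coe_pos.2 hzV).ne' hz
  rw [validStates_eq hn hA1 hA2 hA3, Measure.prod_prod, Measure.pi_pi, mul_eq_zero,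
    Finset.prod_eq_zero_iff] at hV
  rcases hV with ⟨_, _, h⟩ | h
  exacts [hX h, hΘ h]

theorem isProbabilityMeasure_posterior (hn : 1 ≤ n) (hA1 : A1 M) (hA2 : A2 M) (hA3 : A3 M s)
    (hfin : M.evidence s ≠ ∞) : IsProbabilityMeasure (M.posterior s) := by
  refine ⟨?_⟩
  rw [Model.posterior, Measure.smul_apply, withDensity_apply _ .univ, Measure.restrict_univ]
  exact ENNReal.inv_mul_cancel (evidence_ne_zero hn hA1 hA2 hA3) hfin

variable (M s) in
theorem posterior_absolutelyContinuous :
    M.posterior s ≪ (Measure.pi fun _ : Fin n => ν).prod μ :=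
  (withDensity_absolutelyContinuous _ _).smul_left _

variable (M s) in
theorem posterior_compl_validStates : M.posterior s (M.validStates s)ᶜ = 0 := by
  have hV := (measurableSet_validStates M s).compl
  rw [Model.posterior, Measure.smul_apply, withDensity_apply _ hV,
    setLIntegral_congr_fun (g := fun _ => 0) hV fun z hz => ?_, lintegral_zero, smul_zero]
  have : ¬ 0 < M.target s z := hz
  simpa using this

end Positivity

end PrivateMCMC

theorem mainTheorem4 {X T S : Type*} [MeasurableSpace X] [MeasurableSpace T]
    (ν : Measure X) [SigmaFinite ν] (μ : Measure T) [SigmaFinite μ] (n : ℕ) (hn : 1 ≤ n)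
    (M : PrivateMCMC.Model n S ν μ) (Q : PrivateMCMC.Proposals n S ν μ) (s : S)
    (hA1 : PrivateMCMC.A1 M) (hA2 : PrivateMCMC.A2 M) (hA3 : PrivateMCMC.A3 M s)
    (hA4 : PrivateMCMC.A4 M Q s)
    -- the joint posterior given `s` is well defined
    (hfin : M.evidence s ≠ ∞) :
    -- the posterior is a probability distribution that lives on the valid states
    IsProbabilityMeasure (M.posterior s) ∧ M.posterior s (M.validStates s)ᶜ = 0 ∧
    -- the sampler is a Markov chain that does not leave the valid states
    IsMarkovKernel (PrivateMCMC.sampler M Q s) ∧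
    (∀ z ∈ M.validStates s, PrivateMCMC.sampler M Q s z (M.validStates s)ᶜ = 0) ∧
    -- invariance, aperiodicity, irreducibility
    (PrivateMCMC.sampler M Q s).Invariant (M.posterior s) ∧
    PrivateMCMC.IsAperiodicOn (PrivateMCMC.sampler M Q s) (M.validStates s) ∧
    PrivateMCMC.IsIrreducibleWithin (PrivateMCMC.sampler M Q s) (M.validStates s)
      (M.posterior s) n ∧
    -- ergodicity: convergence to the posterior in total variation
    (∀ᵐ z ∂(M.posterior s), Tendsto
      (fun k : ℕ => PrivateMCMC.tvDist ((PrivateMCMC.sampler M Q s ^ k) z) (M.posterior s))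
      atTop (𝓝 0)) ∧
    -- the posterior is the only stationary distribution on the valid states ...
    (∀ ρ : Measure ((Fin n → X) × T), IsProbabilityMeasure ρ → ρ (M.validStates s)ᶜ = 0 →
      (PrivateMCMC.sampler M Q s).Invariant ρ → ρ = M.posterior s) ∧
    -- ... and the only limiting distribution from any valid state
    (∀ z ∈ M.validStates s, ∀ ρ : Measure ((Fin n → X) × T), IsProbabilityMeasure ρ →
      Tendsto (fun k : ℕ => PrivateMCMC.tvDist ((PrivateMCMC.sampler M Q s ^ k) z) ρ)
        atTop (𝓝 0) → ρ = M.posterior s) := by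
  have hprob := PrivateMCMC.isProbabilityMeasure_posterior hn hA1 hA2 hA3 hfin
  have hV := PrivateMCMC.measurableSet_validStates M s
  have hρV := PrivateMCMC.posterior_compl_validStates M s
  have habs := PrivateMCMC.posterior_absolutelyContinuous M s
  have hstay : ∀ z ∈ M.validStates s, PrivateMCMC.sampler M Q s z (M.validStates s)ᶜ = 0 :=
    fun _ hz => PrivateMCMC.sampler_compl_validStates M Q s hz
  have hinv := PrivateMCMC.invariant_sampler M Q s
  have hg := PrivateMCMC.measurable_samplerDensity M Q s
  have hle := PrivateMCMC.withDensity_samplerDensity_le M Q s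
  have hpos : ∀ z ∈ M.validStates s, ∀ w ∈ M.validStates s,
      0 < PrivateMCMC.samplerDensity M Q s z w :=
    fun _ hz _ hw => PrivateMCMC.samplerDensity_pos hn hA1 hA2 hA3 hA4 hz hw
  have hac : ∀ z ∈ M.validStates s, M.posterior s ≪ PrivateMCMC.sampler M Q s z := fun _ hz =>
    PrivateMCMC.absolutelyContinuous_of_withDensity_le hg hle hρV habs hpos hz
  refine ⟨hprob, hρV, inferInstance, hstay, hinv,
    PrivateMCMC.isAperiodicOn_of_absolutelyContinuous hac,
    PrivateMCMC.isIrreducibleWithin_of_absolutelyContinuous hn hac,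
    PrivateMCMC.tendsto_tvDist_pow_ae hg hle hinv hρV habs hpos, ?_, ?_⟩
  · intro ρ _ hρ hρinv
    exact PrivateMCMC.eq_of_invariant hg hle hinv hρV habs hpos hρinv hρ
  · intro z hz ρ _ hlim
    exact PrivateMCMC.eq_of_invariant hg hle hinv hρV habs hpos
      (PrivateMCMC.invariant_of_tendsto_tvDist hlim)
      (PrivateMCMC.compl_eq_zero_of_tendsto_tvDist hstay hV hz hlim)
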